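/- Let $k$ be a positive integer and let $\Lambda$ be a row-finite $k$-graph with no sources: $\Lambda$ is a countable small category with a degree functor $d:\Lambda\to\mathbb{N}^k$ such that whenever $d(\lambda)=m+n$ there are unique $\mu,\nu\in\Lambda$ with $\lambda=\mu\nu$, $d(\mu)=m$, $d(\nu)=n$ (where $\mu\nu$ is defined when $s(\mu)=r(\nu)$); for every vertex $v$ the set of paths with range $v$ and degree $e_i$ is finite for each $1\le i\le k$ and the set of paths with range $v$ and degree $m$ is non-empty for each $m\in\mathbb{N}^k$. For $n\in(\mathbb{N}\cup\{\infty\})^k$ let $\Omega_{k,n}=\{(p,q)\in\mathbb{N}^k\times\mathbb{N}^k:p\le q\le n\}$ be the category with $r(p,q)=p$, $s(p,q)=q$, $d(p,q)=q-p$. Let $W_\Lambda$ be the set of all degree-preserving functors $x:\Omega_{k,n}\to\Lambda$, over all $n$, with $d(x):=n$. For $p\in\mathbb{N}^k$ with $p\le d(x)$ let $\sigma^p x\in W_\Lambda$ be the shift, of degree $d(x)-p$, given by $(\sigma^p x)(a,b)=x(p+a,p+b)$. For $\lambda\in\Lambda$ let $TZ_\Lambda(\lambda)=\lambda W_\Lambda$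 be the set of $x\in W_\Lambda$ with $d(\lambda)\le d(x)$ and $x(0,d(\lambda))=\lambda$. The path groupoid $\mathcal{TG}_\Lambda$ is the set of all $(x,m,y)\in W_\Lambda\times\mathbb{Z}^k\times W_\Lambda$ for which there are $p,q\in\mathbb{N}^k$ with $p\le d(x)$, $q\le d(y)$, $p-q=m$ and $\sigma^p x=\sigma^q y$. Its operations are $r(x,m,y)=x$, $s(x,m,y)=y$, $(x,m,y)(y,n,z)=(x,m+n,z)$ and $(x,m,y)^{-1}=(y,-m,x)$, and its unit space is $\mathcal{TG}_\Lambda^{(0)}=\{(x,0,x):x\in W_\Lambda\}$. For $\lambda,\mu\in\Lambda$ with $s(\lambda)=s(\mu)$ put $$TZ_\Lambda(\lambda*_s\mu)=\{(x,d(\lambda)-d(\mu),y)\in\mathcal{TG}_\Lambda: x\in TZ_\Lambda(\lambda),\ y\in TZ_\Lambda(\mu),\ \sigma^{d(\lambda)}x=\sigma^{d(\mu)}y\}.$$ Give $\mathcal{TG}_\Lambda$ the topology generated by the sets $$TZ_\Lambda(\lambda*_s\mu)\setminus\bigcup_{\nu\in G}TZ_\Lambda(\lambda\nu*_s\mu\nu),$$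 where $s(\lambda)=s(\mu)$ and $G$ is a finite set of paths with range $s(\lambda)$. Then $\mathcal{TG}_\Lambda$ is effective, that is, the interior of its isotropy $\operatorname{Iso}(\mathcal{TG}_\Lambda)=\{a\in\mathcal{TG}_\Lambda:s(a)=r(a)\}$ is equal to $\mathcal{TG}_\Lambda^{(0)}$. -/

import Mathlib

open CategoryTheory

universe v u

/-- A `k`-graph: a countable small category with a degree functor to `ℕ^k` that has the unique
factorisation property.

Convention: the objects are the vertices, and `a ⟶ b` is the set of paths `lam` with range
`r(lam) = a` and source `s(lam) = b`. Thus the composite `lam mu`, defined when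
`s(lam) = r(mu)`, is `lam ≫ mu`. -/
structure KGraph (k : ℕ) where
  Vertex : Type u
  [category : Category.{v} Vertex]
  countable_paths : Countable (Σ a b : Vertex, a ⟶ b)
  /-- the degree map -/
  deg : ∀ {a b : Vertex}, (a ⟶ b) → (Fin k → ℕ)
  deg_id : ∀ a : Vertex, deg (𝟙 a) = 0
  deg_comp : ∀ {a b c : Vertex} (lam : a ⟶ b) (mu : b ⟶ c), deg (lam ≫ mu) = deg lam + deg mu
  factorisation : ∀ {a b : Vertex} (lam : a ⟶ b) (m n : Fin k → ℕ), deg lam = m + n →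
    ∃! t : Σ c : Vertex, (a ⟶ c) × (c ⟶ b),
      t.2.1 ≫ t.2.2 = lam ∧ deg t.2.1 = m ∧ deg t.2.2 = n

attribute [instance] KGraph.category

/-- The objects `{p ∈ ℕ^k : p ≤ n}` of `Ω_{k,n}`, for `n ∈ (ℕ ∪ {∞})^k`. The category `Ω_{k,n}` is
the preorder category of this set: it has exactly one morphism `(p, q)`, with range `p` and
source `q`, for each pair `p ≤ q`. -/
abbrev KGraph.Omega {k : ℕ} (n : Fin k → ℕ∞) : Type :=
  {p : Fin k → ℕ // ∀ i, (p i : ℕ∞) ≤ n i}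

/-- The translation functor `p ↦ m + p` from `Ω_{k, n - m}` to `Ω_{k, n}`, for `m ≤ n`. -/
def KGraph.Omega.translate {k : ℕ} (n : Fin k → ℕ∞) (m : Fin k → ℕ)
    (h : ∀ i, (m i : ℕ∞) ≤ n i) :
    KGraph.Omega (fun i => n i - (m i : ℕ∞)) ⥤ KGraph.Omega n :=
  Monotone.functor
    (f := fun p => ⟨m + p.1, fun i => by
      have h1 := add_le_add_right (p.2 i) (m i : ℕ∞)
      rw [add_tsub_cancel_of_le (h i)] at h1
      simpa using h1⟩)
    (fun p q hpq => Subtype.mk_le_mk.mpr (add_le_add_right (Subtype.coe_le_coe.mpr hpq) m))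

namespace KGraph

variable {k : ℕ} (Lam : KGraph.{v, u} k)

/-- All paths (morphisms) of a `k`-graph, with their range and source. -/
structure Path where
  range : Lam.Vertex
  source : Lam.Vertex
  hom : range ⟶ source

/-- `Lam` is row-finite: `v Lam^{e_i}` is finite for all vertices `v` and `1 ≤ i ≤ k`. -/
def RowFinite : Prop :=
  ∀ (a : Lam.Vertex) (i : Fin k),
    {lam : Σ b : Lam.Vertex, a ⟶ b | Lam.deg lam.2 = Pi.single i 1}.Finite

/-- `Lam` has no sources: `v Lam^m` is nonempty for all vertices `v` and `m ∈ ℕ^k`. -/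
def NoSources : Prop :=
  ∀ (a : Lam.Vertex) (m : Fin k → ℕ), ∃ (b : Lam.Vertex) (lam : a ⟶ b), Lam.deg lam = m

/-- The path space `W_Lam`: all degree-preserving functors `x : Ω_{k,n} → Lam`, over all
`n ∈ (ℕ ∪ {∞})^k`; here `n = d(x)` is the field `deg`. -/
structure PathSpace where
  deg : Fin k → ℕ∞
  toFunctor : Omega deg ⥤ Lam.Vertex
  deg_map : ∀ {p q : Omega deg} (f : p ⟶ q), Lam.deg (toFunctor.map f) = q.1 - p.1

namespace PathSpace

variable {Lam}

/-- The path `x(p, q)`, for `p ≤ q ≤ d(x)`. -/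
def seg (x : Lam.PathSpace) (p q : Fin k → ℕ) (hpq : p ≤ q)
    (hq : ∀ i, (q i : ℕ∞) ≤ x.deg i) : Lam.Path where
  range := x.toFunctor.obj ⟨p, fun i => le_trans (Nat.cast_le.mpr (hpq i)) (hq i)⟩
  source := x.toFunctor.obj ⟨q, hq⟩
  hom := x.toFunctor.map (homOfLE hpq)

/-- The shift `σ^n x`, for `n ≤ d(x)`: it has degree `d(x) - n`, and
`(σ^n x)(p, q) = x(n + p, n + q)`. -/
def shift (x : Lam.PathSpace) (n : Fin k → ℕ) (h : ∀ i, (n i : ℕ∞) ≤ x.deg i) :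
    Lam.PathSpace where
  deg := fun i => x.deg i - (n i : ℕ∞)
  toFunctor := Omega.translate x.deg n h ⋙ x.toFunctor
  deg_map := by
    intro p q f
    rw [Functor.comp_map, x.deg_map]
    exact add_tsub_add_eq_tsub_left n q.1 p.1

theorem ext_seg {x y : Lam.PathSpace} (hd : x.deg = y.deg)
    (h : ∀ (p q : Fin k → ℕ) (hpq : p ≤ q) (hx : ∀ i, (q i : ℕ∞) ≤ x.deg i)
      (hy : ∀ i, (q i : ℕ∞) ≤ y.deg i), x.seg p q hpq hx = y.seg p q hpq hy) : x = y := by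
  obtain ⟨d, F, hF⟩ := x
  obtain ⟨d', F', hF'⟩ := y
  obtain rfl : d = d' := hd
  have hFF : F = F' := by
    apply Functor.hext
    · intro p
      exact congrArg Path.range (h p.1 p.1 le_rfl p.2 p.2)
    · intro p q f
      have h1 := h p.1 q.1 (leOfHom f) q.2 q.2
      simp only [seg, Path.mk.injEq] at h1
      exact h1.2.2
  subst hFF
  rfl

theorem seg_congr (x : Lam.PathSpace) {p q p' q' : Fin k → ℕ} (hp : p = p') (hq : q = q')
    (hpq : p ≤ q) (hx : ∀ i, (q i : ℕ∞) ≤ x.deg i) (hpq' : p' ≤ q')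
    (hx' : ∀ i, (q' i : ℕ∞) ≤ x.deg i) : x.seg p q hpq hx = x.seg p' q' hpq' hx' := by
  subst hp hq
  rfl

theorem shift_shift (x : Lam.PathSpace) (m n : Fin k → ℕ)
    (hm : ∀ i, (m i : ℕ∞) ≤ x.deg i) (hn : ∀ i, (n i : ℕ∞) ≤ (x.shift m hm).deg i)
    (hmn : ∀ i, ((m + n) i : ℕ∞) ≤ x.deg i) :
    (x.shift m hm).shift n hn = x.shift (m + n) hmn := by
  refine ext_seg ?_ ?_
  · funext i
    simp [shift, tsub_add_eq_tsub_tsub]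
  · intro p q hpq hx hy
    exact seg_congr x (add_assoc m n p).symm (add_assoc m n q).symm _ _ _ _

theorem shift_congr {x y : Lam.PathSpace} (hxy : x = y) {m n : Fin k → ℕ} (hmn : m = n)
    (hm : ∀ i, (m i : ℕ∞) ≤ x.deg i) (hn : ∀ i, (n i : ℕ∞) ≤ y.deg i) :
    x.shift m hm = y.shift n hn := by
  subst hxy hmn
  rfl

/-- `(x, m, y)` is a morphism of the path groupoid: there are `p ≤ d(x)` and `q ≤ d(y)` with
`p - q = m` and `σ^p x = σ^q y`. -/
def Related (x : Lam.PathSpace) (m : Fin k → ℤ) (y : Lam.PathSpace) : Prop :=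
  ∃ (p q : Fin k → ℕ) (hp : ∀ i, (p i : ℕ∞) ≤ x.deg i) (hq : ∀ i, (q i : ℕ∞) ≤ y.deg i),
    (∀ i, (p i : ℤ) - (q i : ℤ) = m i) ∧ x.shift p hp = y.shift q hq

theorem Related.refl (x : Lam.PathSpace) : Related x 0 x :=
  ⟨0, 0, by simp, by simp, by simp, rfl⟩

theorem Related.symm {x y : Lam.PathSpace} {m : Fin k → ℤ} (h : Related x m y) :
    Related y (-m) x := by
  obtain ⟨p, q, hp, hq, hm, hs⟩ := h
  exact ⟨q, p, hq, hp, fun i => by simp [← hm i], hs.symm⟩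

/-- If `σ^p x = σ^q y` and `q + a ≤ d(y)`, then `σ^(p+a) x = σ^(q+a) y`. -/
theorem shift_add_eq {x y : Lam.PathSpace} {p q : Fin k → ℕ}
    {hp : ∀ i, (p i : ℕ∞) ≤ x.deg i} {hq : ∀ i, (q i : ℕ∞) ≤ y.deg i}
    (hs : x.shift p hp = y.shift q hq) (a : Fin k → ℕ)
    (ha : ∀ i, ((q + a) i : ℕ∞) ≤ y.deg i) :
    ∃ ha' : ∀ i, ((p + a) i : ℕ∞) ≤ x.deg i, x.shift (p + a) ha' = y.shift (q + a) ha := by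
  have hya : ∀ i, (a i : ℕ∞) ≤ (y.shift q hq).deg i := by
    intro i
    have h1 := ha i
    simp only [Pi.add_apply, Nat.cast_add] at h1
    exact ENat.le_sub_of_add_le_left (ENat.natCast_ne_top _) h1
  have hxa : ∀ i, (a i : ℕ∞) ≤ (x.shift p hp).deg i := by
    rw [hs]; exact hya
  have ha' : ∀ i, ((p + a) i : ℕ∞) ≤ x.deg i := by
    intro i
    have h1 := add_le_add_right (hxa i) (p i : ℕ∞)
    simp only [shift] at h1
    rw [add_tsub_cancel_of_le (hp i)] at h1
    simpa using h1
  refine ⟨ha', ?_⟩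
  rw [← shift_shift x p a hp hxa ha', ← shift_shift y q a hq hya ha]
  exact shift_congr hs rfl _ _

theorem Related.trans {x y z : Lam.PathSpace} {m n : Fin k → ℤ} (h : Related x m y)
    (h' : Related y n z) : Related x (m + n) z := by
  obtain ⟨p, q, hp, hq, hm, hs⟩ := h
  obtain ⟨p', q', hp', hq', hn, hs'⟩ := h'
  have e1 : q + (q ⊔ p' - q) = q ⊔ p' := add_tsub_cancel_of_le le_sup_left
  have e2 : p' + (q ⊔ p' - p') = q ⊔ p' := add_tsub_cancel_of_le le_sup_right
  have hsup : ∀ i, ((q ⊔ p') i : ℕ∞) ≤ y.deg i := by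
    intro i
    rcases le_total (q i) (p' i) with hc | hc
    · simpa [Pi.sup_apply, sup_eq_right.mpr hc] using hp' i
    · simpa [Pi.sup_apply, sup_eq_left.mpr hc] using hq i
  obtain ⟨ha, h1⟩ := shift_add_eq hs (q ⊔ p' - q) (by rw [e1]; exact hsup)
  obtain ⟨hb, h2⟩ := shift_add_eq hs'.symm (q ⊔ p' - p') (by rw [e2]; exact hsup)
  refine ⟨_, _, ha, hb, ?_, ?_⟩
  · intro i
    have f1 := congrFun e1 i
    have f2 := congrFun e2 i
    have g1 := hm i
    have g2 := hn i
    simp only [Pi.add_apply] at f1 f2 ⊢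
    rw [← g1, ← g2]
    push_cast
    omega
  · rw [h1, h2]
    exact shift_congr rfl (e1.trans e2.symm) _ _

/-- The path groupoid of `Lam`: its objects are the elements of `W_Lam`, and its morphisms with
range `x` and source `y` are the triples `(x, m, y)`, here given by `m`. Composition is
`(x, m, y)(y, n, z) = (x, m + n, z)` and inversion is `(x, m, y) ↦ (y, -m, x)`. As in a `k`-graph,
`x ⟶ y` is the set of morphisms with range `x` and source `y`. -/
instance : Groupoid (Lam.PathSpace) where
  Hom x y := {m : Fin k → ℤ // Related x m y}
  id x := ⟨0, Related.refl x⟩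
  comp f g := ⟨f.1 + g.1, f.2.trans g.2⟩
  id_comp f := Subtype.ext (zero_add f.1)
  comp_id f := Subtype.ext (add_zero f.1)
  assoc f g h := Subtype.ext (add_assoc f.1 g.1 h.1)
  inv f := ⟨-f.1, f.2.symm⟩
  inv_comp f := Subtype.ext (neg_add_cancel f.1)
  comp_inv f := Subtype.ext (add_neg_cancel f.1)

/-- `x = lam z`: the path `x` extends `lam`, and `z` is what remains of `x` after `lam`.
(This forces `r(z) = s(lam)` and `d(x) = d(lam) + d(z)`.) -/
def IsConcat {a b : Lam.Vertex} (lam : a ⟶ b) (z x : Lam.PathSpace) : Prop :=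
  ∃ h : ∀ i, (Lam.deg lam i : ℕ∞) ≤ x.deg i,
    x.seg 0 (Lam.deg lam) (fun _ => Nat.zero_le _) h = ⟨a, b, lam⟩ ∧ x.shift (Lam.deg lam) h = z

/-- The cylinder set `TZ(lam) = lam W_Lam`. -/
def cylinder {a b : Lam.Vertex} (lam : a ⟶ b) : Set Lam.PathSpace :=
  {x | ∃ z, IsConcat lam z x}

end PathSpace

end KGraph

/-- The set of all morphisms of a groupoid, with their range and source. -/
structure GroupoidMor (C : Type u) [Groupoid.{v} C] where
  range : C
  source : C
  hom : range ⟶ source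

namespace GroupoidMor

variable (C : Type u) [Groupoid.{v} C]

/-- The unit space: all identity morphisms. -/
def units : Set (GroupoidMor C) := Set.range fun x : C => ⟨x, x, 𝟙 x⟩

/-- The isotropy `Iso(C) = {a : s(a) = r(a)}`. -/
def isotropy : Set (GroupoidMor C) := {a | a.source = a.range}

/-- A groupoid with a topology on its set of morphisms is effective if the interior of the
isotropy is the unit space. -/
def IsEffective [TopologicalSpace (GroupoidMor C)] : Prop :=
  interior (isotropy C) = units C

end GroupoidMor

namespace KGraph

variable {k : ℕ} (Lam : KGraph.{v, u} k)

/-- The set of morphisms `(x, m, y)` of the path groupoid of `Lam`. -/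
abbrev PathGroupoid : Type _ := GroupoidMor Lam.PathSpace

namespace PathGroupoid

variable {Lam}

/-- `TZ(lam *_s mu)`, for paths `lam`, `mu` with the same source: all morphisms
`(x, d(lam) - d(mu), y)` with `x ∈ TZ(lam)`, `y ∈ TZ(mu)` and `σ^d(lam) x = σ^d(mu) y`. -/
def cylinder {a b c : Lam.Vertex} (lam : a ⟶ c) (mu : b ⟶ c) : Set Lam.PathGroupoid :=
  {g | g.range ∈ PathSpace.cylinder lam ∧ g.source ∈ PathSpace.cylinder mu ∧
    (∀ i, g.hom.1 i = (Lam.deg lam i : ℤ) - (Lam.deg mu i : ℤ)) ∧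
    ∃ (hx : ∀ i, (Lam.deg lam i : ℕ∞) ≤ g.range.deg i)
      (hy : ∀ i, (Lam.deg mu i : ℕ∞) ≤ g.source.deg i),
      g.range.shift (Lam.deg lam) hx = g.source.shift (Lam.deg mu) hy}

/-- `TZ(lam *_s mu \ G)`, for a set `G` of paths with range `s(lam)`. -/
def cylinderDiff {a b c : Lam.Vertex} (lam : a ⟶ c) (mu : b ⟶ c)
    (G : Set (Σ w : Lam.Vertex, c ⟶ w)) : Set Lam.PathGroupoid :=
  cylinder lam mu \ ⋃ nu ∈ G, cylinder (lam ≫ nu.2) (mu ≫ nu.2)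

/-- The topology of the path groupoid: the one generated by the sets `TZ(lam *_s mu \ G)`, where
`s(lam) = s(mu)` and `G` is a finite set of paths with range `s(lam)`. -/
instance : TopologicalSpace Lam.PathGroupoid :=
  TopologicalSpace.generateFrom
    {S | ∃ (a b c : Lam.Vertex) (lam : a ⟶ c) (mu : b ⟶ c)
      (G : Set (Σ w : Lam.Vertex, c ⟶ w)), G.Finite ∧ S = cylinderDiff lam mu G}

end PathGroupoid

end KGraph

/-!
The unit space is contained in the interior of the isotropy because it is open: the units `(x, 0, x)`
with `x` starting at the vertex `v` form the basic open set `TZ(v *_s v)`.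

The converse rests on the density of the finite paths in `W_Lam`. Let `(x, m, y)` be a morphism of
the path groupoid, witnessed by `σ^p x = σ^q y` with `p - q = m`. Truncating `x` to degree at most
`p + n` and `y` to degree at most `q + n` gives a morphism with the same `m`, since `σ^p` of the
first truncation and `σ^q` of the second are both the truncation of `σ^p x = σ^q y` to degree at
most `n`. These morphisms converge to `(x, m, y)` as `n → ∞`
(`KGraph.PathGroupoid.tendsto_truncMor`). If `(x, m, x)` is interior to the isotropy, then for some
`n` the two truncations of `x` coincide. Comparing degrees gives
`min (p + n) (d(x)) = min (q + n) (d(x))`. As also `d(x) - p = d(x) - q`, each coordinate with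
`p i ≠ q i` has `d(x) i = ∞`, which contradicts the first equation. So `p = q`, whence `m = 0` and
the morphism is a unit.
-/

namespace KGraph

namespace PathSpace

variable {k : ℕ} {Lam : KGraph.{v, u} k}

/-! ### Truncations of paths -/

/-- The truncation of `x` to degree at most `n`: the restriction of `x` to `Ω_{k, min(n, d(x))}`. -/
noncomputable def trunc (x : Lam.PathSpace) (n : Fin k → ℕ) : Lam.PathSpace where
  deg := fun i => min (n i : ℕ∞) (x.deg i)
  toFunctor := Monotone.functor
    (f := fun p : Omega (fun i => min (n i : ℕ∞) (x.deg i)) =>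
      (⟨p.1, fun i => (p.2 i).trans (min_le_right _ _)⟩ : Omega x.deg))
    (fun _ _ hpq => hpq) ⋙ x.toFunctor
  deg_map := by
    intro p q f
    rw [Functor.comp_map, x.deg_map]
    rfl

theorem le_deg_of_le_trunc_deg {x : Lam.PathSpace} {n m : Fin k → ℕ}
    (h : ∀ i, (m i : ℕ∞) ≤ (x.trunc n).deg i) : ∀ i, (m i : ℕ∞) ≤ x.deg i :=
  fun i => (h i).trans (min_le_right _ _)

theorem le_trunc_deg {x : Lam.PathSpace} {n m : Fin k → ℕ} (hmn : m ≤ n)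
    (h : ∀ i, (m i : ℕ∞) ≤ x.deg i) : ∀ i, (m i : ℕ∞) ≤ (x.trunc n).deg i :=
  fun i => le_min (Nat.cast_le.mpr (hmn i)) (h i)

theorem shift_trunc (x : Lam.PathSpace) (p n : Fin k → ℕ)
    (h : ∀ i, (p i : ℕ∞) ≤ (x.trunc (p + n)).deg i) (h' : ∀ i, (p i : ℕ∞) ≤ x.deg i) :
    (x.trunc (p + n)).shift p h = (x.shift p h').trunc n := by
  refine ext_seg ?_ fun _ _ _ _ _ => rfl
  funext i
  have hp : ((p i : ℕ∞) + n i) - p i = n i :=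
    (ENat.addLECancellable_of_ne_top (ENat.natCast_ne_top _)).add_tsub_cancel_left
  simp only [shift, trunc, Pi.add_apply, Nat.cast_add]
  rcases le_total ((p i : ℕ∞) + n i) (x.deg i) with hc | hc
  · rw [min_eq_left hc, hp, min_eq_left (hp.ge.trans (tsub_le_tsub_right hc _))]
  · rw [min_eq_right hc, min_eq_right ((tsub_le_tsub_right hc _).trans hp.le)]

theorem mem_cylinder_iff {a b : Lam.Vertex} {lam : a ⟶ b} {x : Lam.PathSpace} :
    x ∈ cylinder lam ↔ ∃ h : ∀ i, (Lam.deg lam i : ℕ∞) ≤ x.deg i,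
      x.seg 0 (Lam.deg lam) (fun _ => Nat.zero_le _) h = ⟨a, b, lam⟩ :=
  ⟨fun ⟨_, h, hs, _⟩ => ⟨h, hs⟩, fun ⟨h, hs⟩ => ⟨_, h, hs, rfl⟩⟩

theorem mem_cylinder_of_trunc_mem {a b : Lam.Vertex} {lam : a ⟶ b} {x : Lam.PathSpace}
    {n : Fin k → ℕ} (h : x.trunc n ∈ cylinder lam) : x ∈ cylinder lam := by
  obtain ⟨h, hs⟩ := mem_cylinder_iff.mp h
  exact mem_cylinder_iff.mpr ⟨le_deg_of_le_trunc_deg h, hs⟩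

theorem trunc_mem_cylinder {a b : Lam.Vertex} {lam : a ⟶ b} {x : Lam.PathSpace}
    {n : Fin k → ℕ} (hn : Lam.deg lam ≤ n) (h : x ∈ cylinder lam) :
    x.trunc n ∈ cylinder lam := by
  obtain ⟨h, hs⟩ := mem_cylinder_iff.mp h
  exact mem_cylinder_iff.mpr ⟨le_trunc_deg hn h, hs⟩

theorem mem_cylinder_id (x : Lam.PathSpace) {a : Lam.Vertex}
    (ha : x.toFunctor.obj ⟨0, by simp⟩ = a) : x ∈ cylinder (𝟙 a) := by
  subst ha
  have h0 := Lam.deg_id (x.toFunctor.obj ⟨0, by simp⟩)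
  refine mem_cylinder_iff.mpr ⟨by simp [h0], ?_⟩
  rw [seg_congr x rfl h0 _ _ le_rfl (by simp)]
  exact congrArg (Path.mk _ _) (x.toFunctor.map_id _)

theorem shift_of_eq_zero (x : Lam.PathSpace) {p : Fin k → ℕ} (hp : p = 0)
    (h : ∀ i, (p i : ℕ∞) ≤ x.deg i) : x.shift p h = x := by
  subst hp
  refine ext_seg (by funext i; simp [shift]) fun p q hpq hx hy => ?_
  exact seg_congr x (zero_add p) (zero_add q) _ _ _ _

theorem shift_trunc_eq {x y : Lam.PathSpace} {p q : Fin k → ℕ}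
    {hp : ∀ i, (p i : ℕ∞) ≤ x.deg i} {hq : ∀ i, (q i : ℕ∞) ≤ y.deg i}
    (hs : x.shift p hp = y.shift q hq) (n : Fin k → ℕ)
    (hp' : ∀ i, (p i : ℕ∞) ≤ (x.trunc (p + n)).deg i)
    (hq' : ∀ i, (q i : ℕ∞) ≤ (y.trunc (q + n)).deg i) :
    (x.trunc (p + n)).shift p hp' = (y.trunc (q + n)).shift q hq' := by
  rw [shift_trunc x p n hp' hp, shift_trunc y q n hq' hq, hs]

end PathSpace

namespace PathGroupoid

open PathSpace Filter Topology

variable {k : ℕ} {Lam : KGraph.{v, u} k}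

/-! ### Approximation by morphisms between finite paths -/

/-- The morphism from the truncation of `y` to that of `x` obtained by truncating a morphism
`(x, p - q, y)` with `σ^p x = σ^q y`: after the initial segments of degrees `p` and `q`, both paths
are cut off at degree at most `n`. -/
noncomputable def truncMor (g : Lam.PathGroupoid) {p q : Fin k → ℕ}
    (hp : ∀ i, (p i : ℕ∞) ≤ g.range.deg i) (hq : ∀ i, (q i : ℕ∞) ≤ g.source.deg i)
    (hm : ∀ i, (p i : ℤ) - (q i : ℤ) = g.hom.1 i)
    (hs : g.range.shift p hp = g.source.shift q hq) (n : Fin k → ℕ) : Lam.PathGroupoid where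
  range := g.range.trunc (p + n)
  source := g.source.trunc (q + n)
  hom := ⟨g.hom.1, p, q, le_trunc_deg le_self_add hp, le_trunc_deg le_self_add hq, hm,
    shift_trunc_eq hs n _ _⟩

/-- Membership in a smaller cylinder `TZ(lam nu *_s mu nu)` can be tested on the range and the
source, for morphisms of `TZ(lam *_s mu)`. -/
theorem mem_cylinder_comp {a b c w : Lam.Vertex} {lam : a ⟶ c} {mu : b ⟶ c} (nu : c ⟶ w)
    {g : Lam.PathGroupoid} (hg : g ∈ cylinder lam mu)
    (hr : g.range ∈ PathSpace.cylinder (lam ≫ nu))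
    (hs : g.source ∈ PathSpace.cylinder (mu ≫ nu)) :
    g ∈ cylinder (lam ≫ nu) (mu ≫ nu) := by
  obtain ⟨-, -, hm, hx, hy, he⟩ := hg
  obtain ⟨hr', -⟩ := mem_cylinder_iff.mp hr
  obtain ⟨hs', -⟩ := mem_cylinder_iff.mp hs
  refine ⟨hr, hs, fun i => ?_, hr', hs', ?_⟩
  · rw [hm i, Lam.deg_comp, Lam.deg_comp]
    simp
  · obtain ⟨h, e⟩ := shift_add_eq he (Lam.deg nu) (by rwa [Lam.deg_comp] at hs')
    exact (shift_congr rfl (Lam.deg_comp lam nu) _ h).trans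
      (e.trans (shift_congr rfl (Lam.deg_comp mu nu).symm _ _))

theorem tendsto_truncMor (g : Lam.PathGroupoid) {p q : Fin k → ℕ}
    (hp : ∀ i, (p i : ℕ∞) ≤ g.range.deg i) (hq : ∀ i, (q i : ℕ∞) ≤ g.source.deg i)
    (hm : ∀ i, (p i : ℤ) - (q i : ℤ) = g.hom.1 i)
    (hs : g.range.shift p hp = g.source.shift q hq) :
    Tendsto (truncMor g hp hq hm hs) atTop (𝓝 g) := by
  refine TopologicalSpace.tendsto_nhds_generateFrom_iff.mpr ?_
  rintro _ ⟨a, b, c, lam, mu, G, -, rfl⟩ ⟨hg, hG⟩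
  have hg' := hg
  obtain ⟨hr, hsrc, hd, hx, hy, he⟩ := hg'
  filter_upwards [eventually_ge_atTop (Lam.deg lam ⊔ Lam.deg mu)] with n hn
  have hl : Lam.deg lam ≤ p + n := (le_sup_left.trans hn).trans le_add_self
  have hu : Lam.deg mu ≤ q + n := (le_sup_right.trans hn).trans le_add_self
  -- The remainders after `lam` and `mu` are cut off at the same degree, as `d(lam) - d(mu) = p - q`.
  obtain ⟨t, ht⟩ : ∃ t, p + n = Lam.deg lam + t := ⟨_, (add_tsub_cancel_of_le hl).symm⟩
  have ht' : q + n = Lam.deg mu + t := by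
    funext i
    have h1 := congrFun ht i
    have h2 := hm i
    have h3 := hd i
    simp only [Pi.add_apply] at h1 ⊢
    omega
  refine ⟨⟨trunc_mem_cylinder hl hr, trunc_mem_cylinder hu hsrc, hd,
    le_trunc_deg hl hx, le_trunc_deg hu hy, ?_⟩, ?_⟩
  · refine (shift_congr (congrArg g.range.trunc ht) rfl _ (le_trunc_deg le_self_add hx)).trans
      ((shift_trunc_eq he t _ (le_trunc_deg le_self_add hy)).trans ?_)
    exact shift_congr (congrArg g.source.trunc ht'.symm) rfl _ _
  · intro hmem
    obtain ⟨nu, hnu, h⟩ := Set.mem_iUnion₂.mp hmem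
    exact hG (Set.mem_iUnion₂.mpr ⟨nu, hnu, mem_cylinder_comp nu.2 hg
      (mem_cylinder_of_trunc_mem h.1) (mem_cylinder_of_trunc_mem h.2.1)⟩)

/-- If `σ^p x = σ^q x` and the truncations of `x` to degrees at most `p + n` and `q + n` coincide,
then `p = q`. -/
theorem eq_of_shift_eq_of_trunc_eq {x : Lam.PathSpace} {p q n : Fin k → ℕ}
    {hp : ∀ i, (p i : ℕ∞) ≤ x.deg i} {hq : ∀ i, (q i : ℕ∞) ≤ x.deg i}
    (hs : x.shift p hp = x.shift q hq) (ht : x.trunc (p + n) = x.trunc (q + n)) : p = q := by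
  funext i
  have h1 : x.deg i - (p i : ℕ∞) = x.deg i - (q i : ℕ∞) := congrFun (congrArg PathSpace.deg hs) i
  have h2 : min (((p + n) i : ℕ) : ℕ∞) (x.deg i) = min (((q + n) i : ℕ) : ℕ∞) (x.deg i) :=
    congrFun (congrArg PathSpace.deg ht) i
  have hpi := hp i
  have hqi := hq i
  generalize x.deg i = d at h1 h2 hpi hqi
  cases d with
  | top =>
    simp only [le_top, inf_of_le_left, Nat.cast_inj, Pi.add_apply] at h2
    omega
  | coe d =>
    norm_cast at h1 hpi hqi
    omega

/-! ### The unit space -/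

theorem mem_cylinder_id_id_iff {a : Lam.Vertex} {g : Lam.PathGroupoid} :
    g ∈ cylinder (𝟙 a) (𝟙 a) ↔
      ∃ x ∈ PathSpace.cylinder (𝟙 a), g = ⟨x, x, 𝟙 x⟩ := by
  have h0 := Lam.deg_id a
  constructor
  · obtain ⟨x, y, m, hR⟩ := g
    rintro ⟨hr, -, hm, hx, hy, he⟩
    dsimp only at hr hm hx hy he
    obtain rfl : x = y := by
      rwa [shift_of_eq_zero x h0, shift_of_eq_zero y h0] at he
    obtain rfl : m = 0 := funext fun i => by simpa using hm i
    exact ⟨x, hr, rfl⟩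
  · rintro ⟨x, hx, rfl⟩
    obtain ⟨hx', -⟩ := mem_cylinder_iff.mp hx
    exact ⟨hx, hx, fun i => (sub_self _).symm, hx', hx', rfl⟩

theorem isOpen_units : IsOpen (GroupoidMor.units Lam.PathSpace) := by
  have h : GroupoidMor.units Lam.PathSpace = ⋃ a : Lam.Vertex, cylinder (𝟙 a) (𝟙 a) := by
    ext g
    rw [Set.mem_iUnion]
    constructor
    · rintro ⟨x, rfl⟩
      exact ⟨_, mem_cylinder_id_id_iff.mpr ⟨x, mem_cylinder_id x rfl, rfl⟩⟩
    · rintro ⟨a, ha⟩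
      obtain ⟨x, -, rfl⟩ := mem_cylinder_id_id_iff.mp ha
      exact ⟨x, rfl⟩
  rw [h]
  refine isOpen_iUnion fun a => TopologicalSpace.isOpen_generateFrom_of_mem ?_
  exact ⟨a, a, a, 𝟙 a, 𝟙 a, ∅, Set.finite_empty, by simp [cylinderDiff]⟩

theorem interior_isotropy_subset_units :
    interior (GroupoidMor.isotropy Lam.PathSpace) ⊆ GroupoidMor.units Lam.PathSpace := by
  intro g hg
  have hiso : g ∈ GroupoidMor.isotropy Lam.PathSpace := interior_subset hg
  obtain ⟨p, q, hp, hq, hm, hs⟩ := g.hom.2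
  obtain ⟨n, hn⟩ := ((tendsto_truncMor g hp hq hm hs).eventually
    (isOpen_interior.mem_nhds hg)).exists
  have htrunc : truncMor g hp hq hm hs n ∈ GroupoidMor.isotropy Lam.PathSpace :=
    interior_subset hn
  have ht : g.source.trunc (q + n) = g.range.trunc (p + n) := htrunc
  obtain ⟨x, y, m, hR⟩ := g
  obtain rfl : y = x := hiso
  dsimp only at hp hq hm hs ht
  obtain rfl := eq_of_shift_eq_of_trunc_eq hs ht.symm
  obtain rfl : m = 0 := funext fun i => by rw [← hm i]; simp
  exact ⟨_, rfl⟩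

end PathGroupoid

end KGraph

theorem mainTheorem7 {k : ℕ} (Lam : KGraph.{v, u} k) (hrow : Lam.RowFinite)
    (hsrc : Lam.NoSources) : GroupoidMor.IsEffective Lam.PathSpace := by
  refine (KGraph.PathGroupoid.interior_isotropy_subset_units).antisymm
    (interior_maximal ?_ KGraph.PathGroupoid.isOpen_units)
  rintro _ ⟨x, rfl⟩
  exact rfl
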